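/- Let $\Omega\subseteq\mathbb R^2$ be an open subset of the $(t,x)$-plane. A subset $U$ of the $(t,x)$-plane is called $x$-simple if, for every $t\in\mathbb R$, the section $U_t=\{x\in\mathbb R: (t,x)\in U\}$ is an open interval (bounded or unbounded) or empty. Let $C(\Omega)$ be the real vector space of continuous functions $\Omega\to\mathbb R$, and for an integer $p\ge1$ let $C^p_x(\Omega)\subseteq C(\Omega)$ be the subspace of functions $u$ whose partial derivatives $u_i=\partial^i u/\partial x^i$, $0\le i\le p$, exist and are continuous on $\Omega$. Let $\mathrm{DO}(\Omega)$ be the set of operators $$P=\sum_{i=0}^p g^i(t,x)\,\partial_x^i\colon\ C^p_x(\Omega)\to C(\Omega),\qquad p\ge 1,$$ with coefficients $g^0,\dots,g^p\in C(\Omega)$ and with $g^p(t,x)\neq0$ for all $(t,x)\in\Omega$. If some connected component of $\Omega$ is not $x$-simple, then for every $P\in\mathrm{DO}(\Omega)$ the quotient space $C(\Omega)/\operatorname{im}P$ is infinite-dimensional. -/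

import Mathlib

noncomputable section

namespace ParamODE

/-- The section `U_t = {x | (t, x) ∈ U}` of a subset of the `(t,x)`-plane. -/
def xSection (U : Set (ℝ × ℝ)) (t : ℝ) : Set ℝ := {x | (t, x) ∈ U}

/-- A subset of the `(t,x)`-plane is `x`-simple if each of its sections by a line `t = const` is
an open interval (bounded or not) or empty, that is, an open and order-connected subset of `ℝ`. -/
def IsXSimple (U : Set (ℝ × ℝ)) : Prop :=
  ∀ t : ℝ, IsOpen (xSection U t) ∧ (xSection U t).OrdConnected

variable {Ω : Set (ℝ × ℝ)}

open Classical in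
/-- The function `x ↦ u(t, x)` on the section `Ω_t`, extended by zero outside `Ω_t`. For open `Ω`
its derivatives at points of `Ω_t` do not depend on the extension. -/
def slice (u : C(Ω, ℝ)) (t : ℝ) : ℝ → ℝ :=
  fun x => if h : (t, x) ∈ Ω then u ⟨(t, x), h⟩ else 0

/-- The value `u_i(z)` of the `i`-th partial derivative of `u` with respect to `x`. -/
def xDerivAt (i : ℕ) (u : C(Ω, ℝ)) (z : Ω) : ℝ :=
  iteratedDeriv i (slice u z.1.1) z.1.2

lemma slice_add (u v : C(Ω, ℝ)) (t : ℝ) : slice (u + v) t = slice u t + slice v t := by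
  funext x
  by_cases h : (t, x) ∈ Ω <;> simp [slice, h]

lemma slice_smul (c : ℝ) (u : C(Ω, ℝ)) (t : ℝ) : slice (c • u) t = c • slice u t := by
  funext x
  by_cases h : (t, x) ∈ Ω <;> simp [slice, h]

lemma slice_zero (t : ℝ) : slice (0 : C(Ω, ℝ)) t = fun _ => 0 := by
  funext x
  by_cases h : (t, x) ∈ Ω <;> simp [slice, h]

lemma xDerivAt_add {i p : ℕ} (hi : i ≤ p) {u v : C(Ω, ℝ)} (z : Ω)
    (hu : ContDiffAt ℝ p (slice u z.1.1) z.1.2) (hv : ContDiffAt ℝ p (slice v z.1.1) z.1.2) :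
    xDerivAt i (u + v) z = xDerivAt i u z + xDerivAt i v z := by
  unfold xDerivAt
  rw [slice_add]
  exact iteratedDeriv_add (hu.of_le (by exact_mod_cast hi)) (hv.of_le (by exact_mod_cast hi))

lemma xDerivAt_smul {i p : ℕ} (hi : i ≤ p) (c : ℝ) {u : C(Ω, ℝ)} (z : Ω)
    (hu : ContDiffAt ℝ p (slice u z.1.1) z.1.2) :
    xDerivAt i (c • u) z = c * xDerivAt i u z := by
  unfold xDerivAt
  rw [slice_smul]
  exact iteratedDeriv_const_smul (n := i) (hu.of_le (by exact_mod_cast hi)) c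

/-- The space `C^p_x(Ω)` of the functions from `C(Ω)` that admit derivatives with respect to `x` up
to order `p` which are continuous on `Ω` (as functions of `(t,x)`). -/
def Cx (p : ℕ) (Ω : Set (ℝ × ℝ)) : Submodule ℝ C(Ω, ℝ) where
  carrier := {u | (∀ z : Ω, ContDiffAt ℝ p (slice u z.1.1) z.1.2) ∧
    ∀ i ≤ p, Continuous (xDerivAt i u)}
  add_mem' := by
    rintro u v ⟨hu, hu'⟩ ⟨hv, hv'⟩
    refine ⟨fun z => ?_, fun i hi => ?_⟩
    · rw [slice_add]
      exact (hu z).add (hv z)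
    · rw [show xDerivAt i (u + v) = fun z => xDerivAt i u z + xDerivAt i v z from
        funext fun z => xDerivAt_add hi z (hu z) (hv z)]
      exact (hu' i hi).add (hv' i hi)
  zero_mem' := by
    refine ⟨fun z => ?_, fun i _ => ?_⟩
    · rw [slice_zero]
      exact contDiffAt_const
    · have : xDerivAt i (0 : C(Ω, ℝ)) = fun _ => 0 := by
        funext z
        simp [xDerivAt, slice_zero]
      rw [this]
      exact continuous_const
  smul_mem' := by
    rintro c u ⟨hu, hu'⟩
    refine ⟨fun z => ?_, fun i hi => ?_⟩
    · rw [slice_smul]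
      exact (hu z).const_smul c
    · rw [show xDerivAt i (c • u) = fun z => c * xDerivAt i u z from
        funext fun z => xDerivAt_smul hi c z (hu z)]
      exact continuous_const.mul (hu' i hi)

/-- The operator `u ↦ u_i = ∂^i u / ∂x^i` from `C^p_x(Ω)` to `C(Ω)`, for `0 ≤ i ≤ p`. -/
def xDeriv {p : ℕ} (i : Fin (p + 1)) : Cx p Ω →ₗ[ℝ] C(Ω, ℝ) where
  toFun u := ⟨xDerivAt i u.1, u.2.2 i (Nat.lt_succ_iff.mp i.2)⟩
  map_add' u v := by
    ext z
    exact xDerivAt_add (Nat.lt_succ_iff.mp i.2) z (u.2.1 z) (v.2.1 z)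
  map_smul' c u := by
    ext z
    exact xDerivAt_smul (Nat.lt_succ_iff.mp i.2) c z (u.2.1 z)

/-- `DO(Ω)`: linear differential operators `P = ∑_{i=0}^p g^i ∂_x^i` with coefficients
`g^i ∈ C(Ω)` whose leading coefficient `g^p` vanishes nowhere on `Ω`. -/
structure DO (Ω : Set (ℝ × ℝ)) where
  ord : ℕ
  coeff : Fin (ord + 1) → C(Ω, ℝ)
  lcoef_ne_zero : ∀ z : Ω, coeff (Fin.last ord) z ≠ 0

/-- The operator `P` as a linear map `C^p_x(Ω) → C(Ω)`, `u ↦ ∑_{i=0}^p g^i u_i`, `p = ord P`. -/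
def DO.toLinearMap (P : DO Ω) : Cx P.ord Ω →ₗ[ℝ] C(Ω, ℝ) :=
  ∑ i : Fin (P.ord + 1), LinearMap.mulLeft ℝ (P.coeff i) ∘ₗ xDeriv i

end ParamODE

end


/-!
The vertical segments in `Ω` are the leaves of a foliation whose leaf space is a one-dimensional
manifold mapped to the `t`-axis by a local homeomorphism. If the leaf space is Hausdorff, this map
is injective on each of its components, so the components of `Ω` are `x`-simple. Otherwise there are
a point `(t, c) ∉ Ω` between two points `(t, a)`, `(t, b)` of `Ω` and `τₙ → t` such that the
segments `{τₙ} × [a, b]` lie in `Ω`.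

Bumps `αₙ βₙ` with small disjoint supports around `(τₙ, c)` accumulate only at `(t, c) ∉ Ω`, so
their sum `F` is continuous on `Ω` for every sequence `α`. If `P u = gᵖ F`, then Grönwall's
inequality along `{τₙ} × [a, b]` bounds `αₙ` by a constant `Sₙ`, independent of `u` and `α`, times
the size of the jet of `u` at `(τₙ, a)` and `(τₙ, b)`. These jets converge as `τₙ → t`, so that
`α = O(S)`; but sequences modulo `O(S)` form an infinite-dimensional space.
-/

namespace ParamODE

open Set Filter Topology Asymptotics

section Tubes

variable {Ω W W' : Set (ℝ × ℝ)} {t a b : ℝ}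

lemma eventually_mem_xSection (hW : IsOpen W) (ha : a ∈ xSection W t) :
    ∀ᶠ s in 𝓝 t, a ∈ xSection W s :=
  (hW.preimage (Continuous.prodMk_left a)).mem_nhds ha

lemma eventually_subset_xSection (hΩ : IsOpen Ω) {k : Set ℝ} (hk : IsCompact k)
    (h : k ⊆ xSection Ω t) : ∀ᶠ s in 𝓝 t, k ⊆ xSection Ω s := by
  obtain ⟨U, V, hU, -, htU, hkV, hUV⟩ := generalized_tube_lemma (isCompact_singleton (x := t))
    hk hΩ (by rintro ⟨s, x⟩ ⟨rfl, hx⟩; exact h hx)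
  filter_upwards [hU.mem_nhds (htU rfl)] with s hs x hx
  exact hUV ⟨hs, hkV hx⟩

/-- `Ω` is leaf-separated if vertical segments in `Ω` can converge to a vertical segment with
endpoints in `Ω` only if it lies in `Ω`. This says that the leaf space of the foliation of `Ω` by
vertical segments is Hausdorff. -/
def IsLeafSeparated (Ω : Set (ℝ × ℝ)) : Prop :=
  ∀ ⦃t a b : ℝ⦄, a ∈ xSection Ω t → b ∈ xSection Ω t →
    (∃ᶠ s in 𝓝 t, uIcc a b ⊆ xSection Ω s) → uIcc a b ⊆ xSection Ω t

/-- A tube in `Ω` is an open connected subset that is `x`-simple relative to `Ω`: any two of its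
points on one vertical line are joined by a segment in `Ω`, though not necessarily in the tube. -/
structure IsTube (Ω W : Set (ℝ × ℝ)) : Prop where
  isOpen : IsOpen W
  isPreconnected : IsPreconnected W
  uIcc_subset : ∀ ⦃t a b : ℝ⦄, a ∈ xSection W t → b ∈ xSection W t → uIcc a b ⊆ xSection Ω t

lemma IsTube.xSection_subset (hW : IsTube Ω W) (t : ℝ) : xSection W t ⊆ xSection Ω t :=
  fun _ ha => hW.uIcc_subset ha ha left_mem_uIcc

lemma exists_isTube_mem (hΩ : IsOpen Ω) {z : ℝ × ℝ} (hz : z ∈ Ω) : ∃ W, IsTube Ω W ∧ z ∈ W := by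
  obtain ⟨ε, hε, hball⟩ := Metric.isOpen_iff.1 hΩ z hz
  refine ⟨Metric.ball z ε, ⟨Metric.isOpen_ball, (convex_ball z ε).isPreconnected, ?_⟩,
    Metric.mem_ball_self hε⟩
  intro t a b ha hb x hx
  have ha' : t ∈ Metric.ball z.1 ε ∧ a ∈ Metric.ball z.2 ε := by
    rwa [← mem_prod (p := (t, a)), ball_prod_same]
  have hb' : t ∈ Metric.ball z.1 ε ∧ b ∈ Metric.ball z.2 ε := by
    rwa [← mem_prod (p := (t, b)), ball_prod_same]
  have hx' : x ∈ Metric.ball z.2 ε := (convex_ball z.2 ε).ordConnected.uIcc_subset ha'.2 hb'.2 hx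
  exact hball (ball_prod_same z.1 z.2 ε ▸ ⟨ha'.1, hx'⟩)

/-- The parameters `t` for which the sections of `W` and `W'` lie in one leaf form an open and
closed subset of the interval `pr₁ W ∩ pr₁ W'`. -/
lemma IsTube.uIcc_subset_of_inter_nonempty (hΩ : IsOpen Ω) (hsep : IsLeafSeparated Ω)
    (hW : IsTube Ω W) (hW' : IsTube Ω W') (hne : (W ∩ W').Nonempty)
    (ha : a ∈ xSection W t) (hb : b ∈ xSection W' t) : uIcc a b ⊆ xSection Ω t := by
  set J : Set ℝ :=
    {t | ∃ a ∈ xSection W t, ∃ b ∈ xSection W' t, uIcc a b ⊆ xSection Ω t}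
  have subset_of_mem : ∀ {t}, t ∈ J → ∀ {a b}, a ∈ xSection W t → b ∈ xSection W' t →
      uIcc a b ⊆ xSection Ω t := by
    rintro t ⟨a', ha', b', hb', h⟩ a b ha hb
    have hab' : uIcc a b' ⊆ xSection Ω t :=
      uIcc_subset_uIcc_union_uIcc.trans (union_subset (hW.uIcc_subset ha ha') h)
    exact uIcc_subset_uIcc_union_uIcc.trans (union_subset hab' (hW'.uIcc_subset hb' hb))
  have hJ_open : IsOpen J := by
    refine isOpen_iff_mem_nhds.2 fun t ⟨a, ha, b, hb, h⟩ => ?_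
    filter_upwards [eventually_mem_xSection hW.isOpen ha, eventually_mem_xSection hW'.isOpen hb,
      eventually_subset_xSection hΩ isCompact_uIcc h] with s has hbs hs
    exact ⟨a, has, b, hbs, hs⟩
  have hI : IsPreconnected (Prod.fst '' W ∩ Prod.fst '' W') :=
    ((hW.isPreconnected.image _ continuous_fst.continuousOn).ordConnected.inter
      (hW'.isPreconnected.image _ continuous_fst.continuousOn).ordConnected).isPreconnected
  have hI_subset : Prod.fst '' W ∩ Prod.fst '' W' ⊆ J := by
    refine hI.subset_of_closure_inter_subset hJ_open ?_ ?_
    · obtain ⟨⟨t, a⟩, h, h'⟩ := hne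
      exact ⟨t, ⟨⟨_, h, rfl⟩, ⟨_, h', rfl⟩⟩, a, h, a, h', hW.uIcc_subset h h⟩
    · rintro t ⟨ht, ⟨⟨_, a⟩, ha, rfl⟩, ⟨⟨_, b⟩, hb, rfl⟩⟩
      refine ⟨a, ha, b, hb, hsep (hW.xSection_subset _ ha) (hW'.xSection_subset _ hb) ?_⟩
      refine ((mem_closure_iff_frequently.1 ht).and_eventually
        ((eventually_mem_xSection hW.isOpen ha).and
          (eventually_mem_xSection hW'.isOpen hb))).mono ?_
      rintro s ⟨hs, has, hbs⟩
      exact subset_of_mem hs has hbs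
  exact subset_of_mem (hI_subset ⟨⟨_, ha, rfl⟩, ⟨_, hb, rfl⟩⟩) ha hb

lemma IsTube.union (hΩ : IsOpen Ω) (hsep : IsLeafSeparated Ω) (hW : IsTube Ω W)
    (hW' : IsTube Ω W') (hne : (W ∩ W').Nonempty) : IsTube Ω (W ∪ W') := by
  refine ⟨hW.isOpen.union hW'.isOpen, hW.isPreconnected.union' hne hW'.isPreconnected, ?_⟩
  rintro t a b (ha | ha) (hb | hb)
  · exact hW.uIcc_subset ha hb
  · exact hW.uIcc_subset_of_inter_nonempty hΩ hsep hW' hne ha hb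
  · exact hW'.uIcc_subset_of_inter_nonempty hΩ hsep hW (inter_comm W W' ▸ hne) ha hb
  · exact hW'.uIcc_subset ha hb

lemma IsLeafSeparated.exists_isTube_mem_mem (hΩ : IsOpen Ω) (hsep : IsLeafSeparated Ω)
    {C : Set (ℝ × ℝ)} (hC : IsPreconnected C) (hCΩ : C ⊆ Ω) {z w : ℝ × ℝ} (hz : z ∈ C)
    (hw : w ∈ C) : ∃ W, IsTube Ω W ∧ z ∈ W ∧ w ∈ W := by
  refine hC.induction₂ (fun z w => ∃ W, IsTube Ω W ∧ z ∈ W ∧ w ∈ W) ?_ ?_ ?_ hz hw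
  · intro z hz
    obtain ⟨W, hW, hzW⟩ := exists_isTube_mem hΩ (hCΩ hz)
    filter_upwards [mem_nhdsWithin_of_mem_nhds (hW.isOpen.mem_nhds hzW)] with w hwW
    exact ⟨W, hW, hzW, hwW⟩
  · rintro x y z - - - ⟨W, hW, hxW, hyW⟩ ⟨W', hW', hyW', hzW'⟩
    exact ⟨W ∪ W', hW.union hΩ hsep hW' ⟨y, hyW, hyW'⟩, Or.inl hxW, Or.inr hzW'⟩
  · rintro x y - - ⟨W, hW, hxW, hyW⟩
    exact ⟨W, hW, hyW, hxW⟩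

lemma IsLeafSeparated.isXSimple_connectedComponentIn (hΩ : IsOpen Ω) (hsep : IsLeafSeparated Ω)
    (z : ℝ × ℝ) : IsXSimple (connectedComponentIn Ω z) := by
  refine fun t => ⟨hΩ.connectedComponentIn.preimage (Continuous.prodMk_right t),
    ⟨fun a ha b hb x hx => ?_⟩⟩
  obtain ⟨W, hW, haW, hbW⟩ := hsep.exists_isTube_mem_mem hΩ isPreconnected_connectedComponentIn
    (connectedComponentIn_subset Ω z) ha hb
  have hsegment : IsPreconnected (Prod.mk t '' uIcc a b) :=
    isPreconnected_uIcc.image _ (Continuous.prodMk_right t).continuousOn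
  have hsubset : Prod.mk t '' uIcc a b ⊆ connectedComponentIn Ω (t, a) :=
    hsegment.subset_connectedComponentIn ⟨a, left_mem_uIcc, rfl⟩
      (image_subset_iff.2 (hW.uIcc_subset haW hbW))
  rw [← connectedComponentIn_eq ha] at hsubset
  exact hsubset ⟨x, Icc_subset_uIcc hx, rfl⟩

lemma exists_frequently_Icc_subset_of_not_isLeafSeparated (hsep : ¬ IsLeafSeparated Ω) :
    ∃ t a b, ∃ c ∈ Ioo a b, a ∈ xSection Ω t ∧ b ∈ xSection Ω t ∧ c ∉ xSection Ω t ∧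
      ∃ᶠ s in 𝓝[≠] t, Icc a b ⊆ xSection Ω s := by
  obtain ⟨t, a, b, ha, hb, hfreq, hnot⟩ : ∃ t a b : ℝ, a ∈ xSection Ω t ∧
      b ∈ xSection Ω t ∧ (∃ᶠ s in 𝓝 t, Icc a b ⊆ xSection Ω s) ∧ ¬ Icc a b ⊆ xSection Ω t := by
    simp only [IsLeafSeparated, not_forall] at hsep
    obtain ⟨t, a, b, ha, hb, hfreq, hnot⟩ := hsep
    rcases le_total a b with hab | hba
    · rw [uIcc_of_le hab] at hfreq hnot
      exact ⟨t, a, b, ha, hb, hfreq, hnot⟩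
    · rw [uIcc_of_ge hba] at hfreq hnot
      exact ⟨t, b, a, hb, ha, hfreq, hnot⟩
  obtain ⟨c, hc, hcΩ⟩ := not_subset.1 hnot
  have hac : a ≠ c := fun h => hcΩ (h ▸ ha)
  have hcb : c ≠ b := fun h => hcΩ (h ▸ hb)
  refine ⟨t, a, b, c, ⟨hc.1.lt_of_ne hac, hc.2.lt_of_ne hcb⟩, ha, hb, hcΩ, ?_⟩
  refine frequently_nhdsWithin_iff.2 (hfreq.mono fun s hs => ⟨hs, ?_⟩)
  rintro rfl
  exact hnot hs

end Tubes

section Gronwall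

variable {E : Type*} [NormedAddCommGroup E] [NormedSpace ℝ E] {Y Y' : ℝ → E} {a b K : ℝ}

lemma norm_sub_le_of_norm_deriv_sub_le {F F' : ℝ → E} {J : ℝ} (hab : a ≤ b) (hK : 0 ≤ K)
    (hY : ∀ x ∈ Icc a b, HasDerivAt Y (Y' x) x) (hF : ∀ x ∈ Icc a b, HasDerivAt F (F' x) x)
    (hbound : ∀ x ∈ Icc a b, ‖Y' x - F' x‖ ≤ K * ‖Y x‖)
    (hJ : ∀ x ∈ Icc a b, ‖F x - F a‖ ≤ J) :
    ‖Y b - (F b - F a)‖ ≤ ‖Y a‖ * Real.exp (K * (b - a)) + J * (Real.exp (K * (b - a)) - 1) := by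
  set Z : ℝ → E := fun x => Y x - (F x - F a) with hZ
  have hZ_deriv : ∀ x ∈ Icc a b, HasDerivAt Z (Y' x - F' x) x := fun x hx =>
    (hY x hx).sub ((hF x hx).sub_const _)
  have hZ_bound : ∀ x ∈ Icc a b, ‖Y' x - F' x‖ ≤ K * ‖Z x‖ + K * J := fun x hx => by
    have hYZ : ‖Y x‖ ≤ ‖Z x‖ + J := by
      simpa [hZ] using (norm_add_le (Z x) (F x - F a)).trans (by gcongr; exact hJ x hx)
    calc ‖Y' x - F' x‖ ≤ K * ‖Y x‖ := hbound x hx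
      _ ≤ K * (‖Z x‖ + J) := by gcongr
      _ = K * ‖Z x‖ + K * J := mul_add _ _ _
  have hgronwall : ‖Z b‖ ≤ gronwallBound ‖Z a‖ K (K * J) (b - a) :=
    norm_le_gronwallBound_of_norm_deriv_right_le
      (fun x hx => (hZ_deriv x hx).continuousAt.continuousWithinAt)
      (fun x hx => (hZ_deriv x (Ico_subset_Icc_self hx)).hasDerivWithinAt) le_rfl
      (fun x hx => hZ_bound x (Ico_subset_Icc_self hx)) b (right_mem_Icc.2 hab)
  have hZa : Z a = Y a := by simp [hZ]
  rw [hZa] at hgronwall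
  rcases hK.eq_or_lt with rfl | hK
  · simpa [gronwallBound_K0] using hgronwall
  · simpa [gronwallBound_of_K_ne_0 hK.ne', mul_div_cancel_left₀ J hK.ne'] using hgronwall

lemma norm_right_le_of_norm_deriv_le (hab : a ≤ b) (hK : 0 ≤ K)
    (hY : ∀ x ∈ Icc a b, HasDerivAt Y (Y' x) x) (hbound : ∀ x ∈ Icc a b, ‖Y' x‖ ≤ K * ‖Y x‖) :
    ‖Y b‖ ≤ ‖Y a‖ * Real.exp (K * (b - a)) := by
  simpa using norm_sub_le_of_norm_deriv_sub_le (F := 0) (F' := 0) (J := 0) hab hK hY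
    (fun x _ => hasDerivAt_const x 0) (by simpa using hbound) (by simp)

lemma norm_left_le_of_norm_deriv_le (hab : a ≤ b) (hK : 0 ≤ K)
    (hY : ∀ x ∈ Icc a b, HasDerivAt Y (Y' x) x) (hbound : ∀ x ∈ Icc a b, ‖Y' x‖ ≤ K * ‖Y x‖) :
    ‖Y a‖ ≤ ‖Y b‖ * Real.exp (K * (b - a)) := by
  have hneg : ∀ x ∈ Icc (-b) (-a), -x ∈ Icc a b := fun x hx => ⟨le_neg.1 hx.2, neg_le.1 hx.1⟩
  have hreflected := norm_right_le_of_norm_deriv_le (Y := fun x => Y (-x)) (Y' := fun x => -Y' (-x))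
    (neg_le_neg hab) hK
    (fun x hx => by
      simpa [Function.comp_def] using (hY (-x) (hneg x hx)).scomp x (hasDerivAt_neg x))
    (fun x hx => by simpa using hbound (-x) (hneg x hx))
  simpa only [neg_neg, neg_sub_neg] using hreflected

variable {β : ℝ → ℝ} {e : E}

lemma norm_mul_integral_mul_two_sub_exp_le (hβ : Continuous β) (hβ_nonneg : 0 ≤ β) (hab : a ≤ b)
    (hK : 0 ≤ K) (hY : ∀ x ∈ Icc a b, HasDerivAt Y (Y' x) x)
    (hbound : ∀ x ∈ Icc a b, ‖Y' x - β x • e‖ ≤ K * ‖Y x‖) :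
    ‖e‖ * (∫ x in a..b, β x) * (2 - Real.exp (K * (b - a))) ≤
      ‖Y a‖ * Real.exp (K * (b - a)) + ‖Y b‖ := by
  set B : ℝ → ℝ := fun x => ∫ y in a..x, β y
  have hB_deriv : ∀ x, HasDerivAt B (β x) x := fun x =>
    (hβ.integral_hasStrictDerivAt a x).hasDerivAt
  have hB_mono : Monotone B := monotone_of_hasDerivAt_nonneg hB_deriv hβ_nonneg
  have hBa : B a = 0 := intervalIntegral.integral_same
  have norm_B_smul : ∀ x ∈ Icc a b, ‖B x • e‖ = ‖e‖ * B x := fun x hx => by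
    rw [norm_smul, Real.norm_of_nonneg (hBa ▸ hB_mono hx.1), mul_comm]
  have hduhamel := norm_sub_le_of_norm_deriv_sub_le (F := fun x => B x • e) (J := ‖e‖ * B b)
    hab hK hY (fun x _ => (hB_deriv x).smul_const e) hbound
    (fun x hx => by
      rw [hBa, zero_smul, sub_zero, norm_B_smul x hx]
      gcongr
      exact hB_mono hx.2)
  rw [hBa, zero_smul, sub_zero] at hduhamel
  have htriangle : ‖B b • e‖ - ‖Y b‖ ≤ ‖Y b - B b • e‖ :=
    norm_sub_rev (Y b) _ ▸ norm_sub_norm_le _ _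
  rw [norm_B_smul b (right_mem_Icc.2 hab)] at htriangle
  linarith

lemma norm_mul_integral_le_of_support_subset {l r : ℝ} (hβ : Continuous β) (hβ_nonneg : 0 ≤ β)
    (hsupp : Function.support β ⊆ Ioo l r) (hal : a ≤ l) (hlr : l ≤ r) (hrb : r ≤ b)
    (hK : 0 ≤ K) (hexp : Real.exp (K * (r - l)) ≤ 3 / 2)
    (hY : ∀ x ∈ Icc a b, HasDerivAt Y (Y' x) x)
    (hbound : ∀ x ∈ Icc a b, ‖Y' x - β x • e‖ ≤ K * ‖Y x‖) :
    ‖e‖ * (∫ x in l..r, β x) ≤ 3 * Real.exp (K * (b - a)) * (‖Y a‖ + ‖Y b‖) := by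
  have hβ_zero : ∀ x, x ∉ Ioo l r → β x = 0 := fun x hx =>
    Function.notMem_support.1 fun h => hx (hsupp h)
  have hleft : Icc a l ⊆ Icc a b := Icc_subset_Icc_right (hlr.trans hrb)
  have hmid : Icc l r ⊆ Icc a b := Icc_subset_Icc hal hrb
  have hright : Icc r b ⊆ Icc a b := Icc_subset_Icc_left (hal.trans hlr)
  have hYl : ‖Y l‖ ≤ ‖Y a‖ * Real.exp (K * (b - a)) :=
    (norm_right_le_of_norm_deriv_le hal hK (fun x hx => hY x (hleft hx)) fun x hx => by
      simpa [hβ_zero x fun h => hx.2.not_gt h.1] using hbound x (hleft hx)).trans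
    (by gcongr; exact hlr.trans hrb)
  have hYr : ‖Y r‖ ≤ ‖Y b‖ * Real.exp (K * (b - a)) :=
    (norm_left_le_of_norm_deriv_le hrb hK (fun x hx => hY x (hright hx)) fun x hx => by
      simpa [hβ_zero x fun h => hx.1.not_gt h.2] using hbound x (hright hx)).trans
    (by gcongr; exact hal.trans hlr)
  have hamplitude := norm_mul_integral_mul_two_sub_exp_le hβ hβ_nonneg hlr hK
    (fun x hx => hY x (hmid hx)) fun x hx => hbound x (hmid hx)
  have hI : 0 ≤ ‖e‖ * ∫ x in l..r, β x :=
    mul_nonneg (norm_nonneg e) (intervalIntegral.integral_nonneg hlr fun x _ => hβ_nonneg x)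
  have hhalf : ‖e‖ * (∫ x in l..r, β x) * (1 / 2) ≤ ‖Y l‖ * (3 / 2) + ‖Y r‖ := calc
    _ ≤ ‖e‖ * (∫ x in l..r, β x) * (2 - Real.exp (K * (r - l))) := by gcongr; linarith
    _ ≤ ‖Y l‖ * Real.exp (K * (r - l)) + ‖Y r‖ := hamplitude
    _ ≤ ‖Y l‖ * (3 / 2) + ‖Y r‖ := by gcongr
  linarith [norm_nonneg (Y r)]

end Gronwall

section Jets

/-- The `(p - 1)`-jet `(v, v', …, v⁽ᵖ⁻¹⁾)` of `v` at `x`, the unknown of the first order system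
equivalent to a differential equation of order `p`. -/
noncomputable def jet (p : ℕ) (v : ℝ → ℝ) (x : ℝ) : Fin p → ℝ := fun i => iteratedDeriv i v x

/-- The last basis vector of `ℝᵖ`, along which the right-hand side of a scalar equation of order `p`
enters the first order system for the jet. -/
def lastUnit (p : ℕ) : Fin p → ℝ := fun i => if (i : ℕ) + 1 = p then 1 else 0

variable {p : ℕ} {v : ℝ → ℝ} {x : ℝ}

lemma le_norm_smul_lastUnit (hp : 1 ≤ p) (A : ℝ) : |A| ≤ ‖A • lastUnit p‖ := by
  simpa [lastUnit, Nat.sub_add_cancel hp] using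
    norm_le_pi_norm (A • lastUnit p) ⟨p - 1, Nat.sub_lt hp one_pos⟩

lemma hasDerivAt_jet (hv : ContDiffAt ℝ p v x) : HasDerivAt (jet p v) (jet p (deriv v) x) x := by
  refine hasDerivAt_pi.2 fun i => ?_
  have hdiff : DifferentiableAt ℝ (iteratedDeriv i v) x := by
    rw [← differentiableWithinAt_univ, ← iteratedDerivWithin_univ]
    exact hv.contDiffWithinAt.differentiableWithinAt_iteratedDerivWithin (Nat.cast_lt.2 i.2)
      (by simp)
  simpa only [jet, ← iteratedDeriv_succ', iteratedDeriv_succ] using hdiff.hasDerivAt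

lemma norm_jet_deriv_sub_le {c : Fin p → ℝ} {y : ℝ}
    (h : iteratedDeriv p v x = y - ∑ i, c i * jet p v x i) :
    ‖jet p (deriv v) x - y • lastUnit p‖ ≤ (1 + ∑ i, |c i|) * ‖jet p v x‖ := by
  have hsum_nonneg : 0 ≤ ∑ i, |c i| := Finset.sum_nonneg fun i _ => abs_nonneg (c i)
  refine (pi_norm_le_iff_of_nonneg (by positivity)).2 fun i => ?_
  by_cases hi : (i : ℕ) + 1 = p
  · have hcomp : (jet p (deriv v) x - y • lastUnit p) i = -∑ j, c j * jet p v x j := by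
      simp [jet, lastUnit, hi, ← iteratedDeriv_succ', h]
    calc ‖(jet p (deriv v) x - y • lastUnit p) i‖ ≤ ∑ j, ‖c j * jet p v x j‖ := by
          rw [hcomp, norm_neg]
          exact norm_sum_le _ _
      _ ≤ ∑ j, |c j| * ‖jet p v x‖ := by
          gcongr with j
          exact (norm_mul_le _ _).trans (by gcongr; exacts [le_rfl, norm_le_pi_norm _ j])
      _ = (∑ j, |c j|) * ‖jet p v x‖ := (Finset.sum_mul ..).symm
      _ ≤ (1 + ∑ j, |c j|) * ‖jet p v x‖ := by gcongr; linarith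
  · have hcomp : (jet p (deriv v) x - y • lastUnit p) i = jet p v x ⟨i + 1, by omega⟩ := by
      simp [jet, lastUnit, hi, ← iteratedDeriv_succ']
    rw [hcomp]
    exact (norm_le_pi_norm _ _).trans
      (le_mul_of_one_le_left (norm_nonneg _) (le_add_of_nonneg_right hsum_nonneg))

lemma isBigO_one_jet {Ω : Set (ℝ × ℝ)} (u : Cx p Ω) {ι : Type*} {l : Filter ι} {τ : ι → ℝ}
    {t a : ℝ} (ha : a ∈ xSection Ω t) (hτ : Tendsto τ l (𝓝 t))
    (hmem : ∀ n, a ∈ xSection Ω (τ n)) :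
    (fun n => jet p (slice u.1 (τ n)) a) =O[l] fun _ => (1 : ℝ) := by
  have hpoint : Tendsto (fun n => (⟨(τ n, a), hmem n⟩ : Ω)) l (𝓝 ⟨(t, a), ha⟩) :=
    tendsto_subtype_rng.2 (hτ.prodMk_nhds tendsto_const_nhds)
  have hjet : Tendsto (fun n => jet p (slice u.1 (τ n)) a) l (𝓝 (jet p (slice u.1 t) a)) :=
    tendsto_pi_nhds.2 fun i => ((u.2.2 i i.2.le).tendsto _).comp hpoint
  exact hjet.isBigO_one ℝ

end Jets

section Operator

variable {Ω : Set (ℝ × ℝ)} (P : DO Ω)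

/-- The coefficients `gⁱ / gᵖ`, `i < p`, of the monic operator proportional to `P`. -/
noncomputable def DO.monicCoeff (i : Fin P.ord) : C(Ω, ℝ) where
  toFun z := P.coeff i.castSucc z / P.coeff (Fin.last P.ord) z
  continuous_toFun := (P.coeff _).continuous.div (P.coeff _).continuous P.lcoef_ne_zero

lemma DO.coeff_last_mul_monicCoeff (i : Fin P.ord) (z : Ω) :
    P.coeff (Fin.last P.ord) z * P.monicCoeff i z = P.coeff i.castSucc z :=
  mul_div_cancel₀ _ (P.lcoef_ne_zero z)

/-- The function `1 + ∑ᵢ |gⁱ / gᵖ|`, which bounds the matrix of the first order system for the jet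
of a solution of `P u = f`. -/
noncomputable def DO.systemBound : C(Ω, ℝ) := 1 + ∑ i, |P.monicCoeff i|

lemma DO.toLinearMap_apply (u : Cx P.ord Ω) (z : Ω) :
    P.toLinearMap u z = ∑ i, P.coeff i z * xDerivAt i u.1 z := by
  simp [DO.toLinearMap, xDeriv, ContinuousMap.sum_apply]

variable {P}

lemma DO.xDerivAt_ord_eq {u : Cx P.ord Ω} {z : Ω} {y : ℝ}
    (h : P.toLinearMap u z = P.coeff (Fin.last P.ord) z * y) :
    xDerivAt P.ord u.1 z = y - ∑ i : Fin P.ord, P.monicCoeff i z * xDerivAt i u.1 z := by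
  have hsum : P.coeff (Fin.last P.ord) z * ∑ i : Fin P.ord, P.monicCoeff i z * xDerivAt i u.1 z =
      ∑ i : Fin P.ord, P.coeff i.castSucc z * xDerivAt i u.1 z := by
    rw [Finset.mul_sum]
    refine Finset.sum_congr rfl fun i _ => ?_
    rw [← mul_assoc, P.coeff_last_mul_monicCoeff]
  rw [DO.toLinearMap_apply, Fin.sum_univ_castSucc] at h
  simp only [Fin.val_castSucc, Fin.val_last] at h
  apply mul_left_cancel₀ (P.lcoef_ne_zero z)
  linear_combination h + hsum

lemma DO.norm_jet_deriv_slice_sub_le {u : Cx P.ord Ω} {z : Ω} {y : ℝ}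
    (h : P.toLinearMap u z = P.coeff (Fin.last P.ord) z * y) :
    ‖jet P.ord (deriv (slice u.1 z.1.1)) z.1.2 - y • lastUnit P.ord‖ ≤
      P.systemBound z * ‖jet P.ord (slice u.1 z.1.1) z.1.2‖ := by
  simpa [DO.systemBound, ContinuousMap.sum_apply] using norm_jet_deriv_sub_le (DO.xDerivAt_ord_eq h)

lemma exists_nonneg_forall_le_of_Icc_subset_xSection (q : C(Ω, ℝ)) {s a b : ℝ}
    (hseg : Icc a b ⊆ xSection Ω s) :
    ∃ K, 0 ≤ K ∧ ∀ x (hx : x ∈ Icc a b), q ⟨(s, x), hseg hx⟩ ≤ K := by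
  have hcont : Continuous fun x : Icc a b => q ⟨(s, x), hseg x.2⟩ := by fun_prop
  obtain ⟨K, hK⟩ := isCompact_univ.bddAbove_image hcont.continuousOn
  exact ⟨max 0 K, le_max_left _ _, fun x hx => (hK ⟨⟨x, hx⟩, mem_univ _, rfl⟩).trans
    (le_max_right _ _)⟩

lemma DO.abs_mul_integral_le (hP : 1 ≤ P.ord) {s a b l r K A : ℝ} {β : ℝ → ℝ}
    (hseg : Icc a b ⊆ xSection Ω s) (hK : 0 ≤ K)
    (hbound : ∀ x (hx : x ∈ Icc a b), P.systemBound ⟨(s, x), hseg hx⟩ ≤ K)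
    (hβ : Continuous β) (hβ_nonneg : 0 ≤ β) (hsupp : Function.support β ⊆ Ioo l r)
    (hal : a ≤ l) (hlr : l ≤ r) (hrb : r ≤ b) (hexp : Real.exp (K * (r - l)) ≤ 3 / 2)
    {u : Cx P.ord Ω} {F : C(Ω, ℝ)} (hu : P.toLinearMap u = P.coeff (Fin.last P.ord) * F)
    (hF : ∀ x (hx : x ∈ Icc a b), F ⟨(s, x), hseg hx⟩ = A * β x) :
    |A| * (∫ x in l..r, β x) ≤ 3 * Real.exp (K * (b - a)) *
      (‖jet P.ord (slice u.1 s) a‖ + ‖jet P.ord (slice u.1 s) b‖) := by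
  have hsystem : ∀ x ∈ Icc a b, ‖jet P.ord (deriv (slice u.1 s)) x - β x • A • lastUnit P.ord‖ ≤
      K * ‖jet P.ord (slice u.1 s) x‖ := fun x hx => by
    have heq : P.toLinearMap u ⟨(s, x), hseg hx⟩ =
        P.coeff (Fin.last P.ord) ⟨(s, x), hseg hx⟩ * (A * β x) := by
      rw [hu, ContinuousMap.mul_apply, hF x hx]
    rw [smul_smul, mul_comm (β x)]
    exact (DO.norm_jet_deriv_slice_sub_le heq).trans (by gcongr; exact hbound x hx)
  have hI : 0 ≤ ∫ x in l..r, β x := intervalIntegral.integral_nonneg hlr fun x _ => hβ_nonneg x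
  calc |A| * (∫ x in l..r, β x) ≤ ‖A • lastUnit P.ord‖ * ∫ x in l..r, β x := by
        gcongr
        exact le_norm_smul_lastUnit hP A
    _ ≤ _ := norm_mul_integral_le_of_support_subset hβ hβ_nonneg hsupp hal hlr hrb hK hexp
        (fun x hx => hasDerivAt_jet (u.2.1 ⟨(s, x), hseg hx⟩)) hsystem

end Operator

section Bumps

/-- The continuous function `∑ₙ αₙ fₙ`, depending linearly on arbitrary coefficients `α`, where the
functions `fₙ` are continuous with locally finite supports. -/
noncomputable def locallyFiniteSum {ι X R : Type*} [TopologicalSpace X] [CommSemiring R]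
    [TopologicalSpace R] [IsTopologicalSemiring R] (f : ι → C(X, R))
    (hf : LocallyFinite fun n => Function.support (f n)) : (ι → R) →ₗ[R] C(X, R) where
  toFun α :=
    { toFun := fun x => ∑ᶠ n, α n * f n x
      continuous_toFun := continuous_finsum (fun n => continuous_const.mul (f n).continuous)
        (hf.subset fun n => Function.support_mul_subset_right _ _) }
  map_add' α α' := by
    ext x
    have hfin : ∀ α : ι → R, (Function.support fun n => α n * f n x).Finite := fun α =>
      (hf.point_finite x).subset fun n hn => right_ne_zero_of_mul hn
    simp only [ContinuousMap.coe_mk, ContinuousMap.add_apply, Pi.add_apply, add_mul]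
    exact finsum_add_distrib (hfin α) (hfin α')
  map_smul' k α := by
    ext x
    have hfin : (Function.support fun n => α n * f n x).Finite :=
      (hf.point_finite x).subset fun n hn => right_ne_zero_of_mul hn
    simp only [ContinuousMap.coe_mk, ContinuousMap.smul_apply, Pi.smul_apply, smul_eq_mul,
      RingHom.id_apply, mul_assoc]
    exact (mul_finsum' _ k hfin).symm

lemma locallyFinite_preimage_ball {X : Type*} [MetricSpace X] {s : Set X} {v : X} (hv : v ∉ s)
    {w : ℕ → X} {ρ : ℕ → ℝ} (hw : Tendsto w atTop (𝓝 v)) (hρ : Tendsto ρ atTop (𝓝 0)) :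
    LocallyFinite fun n => ((↑) ⁻¹' Metric.ball (w n) (ρ n) : Set s) := by
  intro z
  have hd : 0 < dist (z : X) v := dist_pos.2 fun h => hv (h ▸ z.2)
  refine ⟨Metric.ball z (dist (z : X) v / 3), Metric.ball_mem_nhds _ (by positivity), ?_⟩
  have hw_near : ∀ᶠ n in atTop, dist (w n) v < dist (z : X) v / 3 :=
    hw (Metric.ball_mem_nhds _ (by positivity))
  have hρ_small : ∀ᶠ n in atTop, ρ n < dist (z : X) v / 3 := hρ.eventually_lt_const (by positivity)
  rw [← Nat.cofinite_eq_atTop] at hw_near hρ_small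
  refine (hw_near.and hρ_small).subset ?_
  rintro n ⟨y, hyw, hyz⟩ ⟨hwv, hρz⟩
  have hyw' : dist (y : X) (w n) < ρ n := hyw
  have hzy : dist (z : X) y < dist (z : X) v / 3 := dist_comm z y ▸ hyz
  linarith [dist_triangle4 (z : X) y (w n) v]

lemma exists_seq_tendsto_of_frequently {X : Type*} [MetricSpace X] {x : X} {p : X → Prop}
    (h : ∃ᶠ y in 𝓝[≠] x, p y) :
    ∃ τ : ℕ → X, Tendsto τ atTop (𝓝 x) ∧ (∀ n, p (τ n) ∧ 0 < dist (τ n) x) ∧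
      Pairwise fun m n => dist (τ n) x / 2 ≤ dist (τ m) (τ n) := by
  obtain ⟨τ, hτ, hhalf⟩ := exists_seq_of_forall_finset_exists (fun y => p y ∧ 0 < dist y x)
    (fun y y' => dist y' x ≤ 1 / 2 * dist y x) fun s hs => by
      have hnear : ∀ᶠ y in 𝓝[≠] x, ∀ y' ∈ s, dist y x ≤ 1 / 2 * dist y' x :=
        (Finset.eventually_all s).2 fun y' hy' => mem_nhdsWithin_of_mem_nhds <|
          Metric.closedBall_mem_nhds x (mul_pos one_half_pos (hs y' hy').2)
      obtain ⟨y, ⟨hpy, hy⟩, hyx⟩ := ((h.and_eventually hnear).and_eventually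
        self_mem_nhdsWithin).exists
      exact ⟨y, ⟨hpy, dist_pos.2 hyx⟩, hy⟩
  refine ⟨τ, tendsto_iff_dist_tendsto_zero.2 ?_, hτ, fun m n hmn => ?_⟩
  · have hgeom : ∀ n, dist (τ n) x ≤ (1 / 2) ^ n * dist (τ 0) x := fun n =>
      le_geom (u := fun n => dist (τ n) x) (by norm_num) n fun k _ => hhalf k (k + 1) k.lt_succ_self
    refine squeeze_zero (fun _ => dist_nonneg) hgeom ?_
    simpa using (tendsto_pow_atTop_nhds_zero_of_lt_one (r := (1 / 2 : ℝ)) (by norm_num)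
      (by norm_num)).mul_const (dist (τ 0) x)
  · have hpos := (hτ n).2
    rcases hmn.lt_or_gt with hmn | hnm
    · linarith [hhalf m n hmn, dist_triangle (τ m) (τ n) x]
    · linarith [hhalf n m hnm, dist_triangle_left (τ n) x (τ m)]

lemma exists_linearMap_eq_mul_bump {Ω : Set (ℝ × ℝ)} {t c : ℝ} (htc : c ∉ xSection Ω t)
    {τ ρ : ℕ → ℝ} (hτ : Tendsto τ atTop (𝓝 t)) (hρ : Tendsto ρ atTop (𝓝 0))
    (hρ_pos : ∀ n, 0 < ρ n) (hsep : Pairwise fun m n => ρ n ≤ dist (τ m) (τ n)) :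
    ∃ (T : (ℕ → ℝ) →ₗ[ℝ] C(Ω, ℝ)) (β : ℕ → ℝ → ℝ), (∀ n, Continuous (β n)) ∧ (∀ n, 0 ≤ β n) ∧
      (∀ n, Function.support (β n) = Ioo (c - ρ n) (c + ρ n)) ∧
      ∀ α n x (hx : x ∈ xSection Ω (τ n)), T α ⟨(τ n, x), hx⟩ = α n * β n x := by
  let φ : ∀ n, ContDiffBump (τ n, c) := fun n =>
    ⟨ρ n / 2, ρ n, half_pos (hρ_pos n), half_lt_self (hρ_pos n)⟩
  let f : ℕ → C(Ω, ℝ) := fun n => ⟨fun z => φ n z, (φ n).continuous.comp continuous_subtype_val⟩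
  have hf : LocallyFinite fun n => Function.support (f n) :=
    (locallyFinite_preimage_ball (s := Ω) (v := (t, c)) (w := fun n => (τ n, c)) htc
      (hτ.prodMk_nhds tendsto_const_nhds) hρ).subset fun n z hz =>
        (φ n).support_eq.subset (show (z : ℝ × ℝ) ∈ Function.support (φ n) from hz)
  refine ⟨locallyFiniteSum f hf, fun n x => φ n (τ n, x),
    fun n => (φ n).continuous.comp (Continuous.prodMk_right _), fun n x => (φ n).nonneg,
    fun n => ?_, fun α n x hx => ?_⟩
  · rw [← Real.ball_eq_Ioo]
    ext x
    have hmem : (τ n, x) ∈ Function.support (φ n) ↔ (τ n, x) ∈ Metric.ball (τ n, c) (ρ n) := by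
      rw [(φ n).support_eq]
    simpa [Prod.dist_eq, hρ_pos n] using hmem
  · refine finsum_eq_single _ n fun m hm => mul_eq_zero_of_right _ ((φ m).zero_of_le_dist ?_)
    exact (hsep hm.symm).trans (le_max_left _ _)

end Bumps

section Growth

lemma exists_pos_le_exp_le {δ : ℝ} (hδ : 0 < δ) (K : ℝ) :
    ∃ ρ, 0 < ρ ∧ ρ ≤ δ ∧ Real.exp (K * (2 * ρ)) ≤ 3 / 2 := by
  have hexp : Tendsto (fun ρ : ℝ => Real.exp (K * (2 * ρ))) (𝓝[>] 0) (𝓝 1) :=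
    (Continuous.tendsto' (by fun_prop) 0 1 (by simp)).mono_left nhdsWithin_le_nhds
  have hle : ∀ᶠ ρ in 𝓝[>] (0 : ℝ), ρ ∈ Ioc 0 δ := Ioc_mem_nhdsGT hδ
  obtain ⟨ρ, hρ, hρ_exp⟩ :=
    (hle.and (hexp.eventually_le_const (show (1 : ℝ) < 3 / 2 by norm_num))).exists
  exact ⟨ρ, hρ.1, hρ.2, hρ_exp⟩

lemma DO.exists_linearMap_isBigO {Ω : Set (ℝ × ℝ)} (P : DO Ω) (hP : 1 ≤ P.ord) {t a b c : ℝ}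
    (hc : c ∈ Ioo a b) (hta : a ∈ xSection Ω t) (htb : b ∈ xSection Ω t)
    (htc : c ∉ xSection Ω t) (hfreq : ∃ᶠ s in 𝓝[≠] t, Icc a b ⊆ xSection Ω s) :
    ∃ (T : (ℕ → ℝ) →ₗ[ℝ] C(Ω, ℝ)) (S : ℕ → ℝ), (∀ n, S n ≠ 0) ∧
      ∀ α, T α ∈ LinearMap.range P.toLinearMap → α =O[atTop] S := by
  have hab : a ≤ b := (hc.1.trans hc.2).le
  obtain ⟨τ, hτ, hτ_seg, hτ_sep⟩ := exists_seq_tendsto_of_frequently hfreq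
  have hseg : ∀ n, Icc a b ⊆ xSection Ω (τ n) := fun n => (hτ_seg n).1
  choose K hK hK_bound using fun n =>
    exists_nonneg_forall_le_of_Icc_subset_xSection P.systemBound (hseg n)
  choose ρ hρ_pos hρ_le hρ_exp using fun n => exists_pos_le_exp_le
    (lt_min (half_pos (hτ_seg n).2) (lt_min (sub_pos.2 hc.1) (sub_pos.2 hc.2))) (K n)
  simp only [le_min_iff] at hρ_le
  have hρ : Tendsto ρ atTop (𝓝 0) :=
    squeeze_zero (fun n => (hρ_pos n).le) (fun n => (hρ_le n).1)
      (by simpa using (tendsto_iff_dist_tendsto_zero.1 hτ).div_const 2)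
  obtain ⟨T, β, hβ, hβ_nonneg, hβ_supp, hT⟩ := exists_linearMap_eq_mul_bump htc hτ hρ hρ_pos
    fun m n hmn => (hρ_le n).1.trans (hτ_sep hmn)
  set I : ℕ → ℝ := fun n => ∫ x in (c - ρ n)..(c + ρ n), β n x
  have hI_pos : ∀ n, 0 < I n := fun n =>
    intervalIntegral.intervalIntegral_pos_of_pos_on ((hβ n).intervalIntegrable _ _)
      (fun x hx => (hβ_nonneg n x).lt_of_ne' ((hβ_supp n).superset hx)) (by linarith [hρ_pos n])
  refine ⟨LinearMap.mulLeft ℝ (P.coeff (Fin.last P.ord)) ∘ₗ T,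
    fun n => Real.exp (K n * (b - a)) / I n, fun n => (div_pos (Real.exp_pos _) (hI_pos n)).ne', ?_⟩
  rintro α ⟨u, hu⟩
  set N : ℕ → ℝ := fun n =>
    ‖jet P.ord (slice u.1 (τ n)) a‖ + ‖jet P.ord (slice u.1 (τ n)) b‖
  have hN_bdd : N =O[atTop] fun _ => (1 : ℝ) :=
    (isBigO_one_jet u hta hτ fun n => hseg n (left_mem_Icc.2 hab)).norm_left.add
      (isBigO_one_jet u htb hτ fun n => hseg n (right_mem_Icc.2 hab)).norm_left
  have hα : ∀ n, |α n| * I n ≤ 3 * Real.exp (K n * (b - a)) * N n := fun n =>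
    P.abs_mul_integral_le hP (hseg n) (hK n) (hK_bound n) (hβ n) (hβ_nonneg n) (hβ_supp n).subset
      (by linarith [(hρ_le n).2.1]) (by linarith [hρ_pos n]) (by linarith [(hρ_le n).2.2])
      (by convert hρ_exp n using 3; ring) hu fun x hx => hT α n x (hseg n hx)
  have hα_isBigO : α =O[atTop] fun n => Real.exp (K n * (b - a)) / I n * N n := by
    refine IsBigO.of_bound 3 (Eventually.of_forall fun n => ?_)
    have hN_nonneg : 0 ≤ N n := add_nonneg (norm_nonneg _) (norm_nonneg _)
    have hS_nonneg : 0 ≤ Real.exp (K n * (b - a)) / I n :=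
      div_nonneg (Real.exp_nonneg _) (hI_pos n).le
    rw [Real.norm_eq_abs, Real.norm_of_nonneg (mul_nonneg hS_nonneg hN_nonneg),
      div_mul_eq_mul_div, mul_div_assoc', le_div_iff₀ (hI_pos n), ← mul_assoc]
    exact hα n
  simpa using hα_isBigO.trans ((isBigO_refl _ _).mul hN_bdd)

/-- The sequences `n ↦ S n * z n * q (z n)` with `q ≠ 0` a polynomial and `z n → ∞` are not
`O(S)`. -/
lemma not_finiteDimensional_quotient_of_isBigO {𝕜 V : Type*} [NontriviallyNormedField 𝕜]
    [AddCommGroup V] [Module 𝕜 V] (R : Submodule 𝕜 V) (T : (ℕ → 𝕜) →ₗ[𝕜] V) {S : ℕ → 𝕜}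
    (hS : ∀ n, S n ≠ 0) (hT : ∀ α, T α ∈ R → α =O[atTop] S) : ¬ FiniteDimensional 𝕜 (V ⧸ R) := by
  intro hfin
  obtain ⟨k, hk⟩ := NormedField.exists_one_lt_norm 𝕜
  let ev : Polynomial 𝕜 →ₗ[𝕜] (ℕ → 𝕜) :=
    { toFun := fun q n => S n * (Polynomial.X * q).eval (k ^ n)
      map_add' := fun q r => by ext n; simp [mul_add]
      map_smul' := fun c q => by ext n; simp [mul_left_comm] }
  refine Polynomial.not_finite (R := 𝕜) (Module.Finite.of_injective (R.mkQ ∘ₗ T ∘ₗ ev)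
    ((injective_iff_map_eq_zero _).2 fun q hq => ?_))
  by_contra hq_ne
  have hdeg : 0 < (Polynomial.X * q).degree := by
    rw [Polynomial.degree_mul, Polynomial.degree_X, Polynomial.degree_eq_natDegree hq_ne]
    exact_mod_cast Nat.add_pos_left one_pos _
  have hlim : Tendsto (fun n : ℕ => ‖(Polynomial.X * q).eval (k ^ n)‖) atTop atTop :=
    (Polynomial.X * q).tendsto_norm_atTop hdeg
      (by simpa using tendsto_pow_atTop_atTop_of_one_lt hk)
  obtain ⟨C, hC⟩ := (hT (ev q) ((Submodule.Quotient.mk_eq_zero R).1 hq)).bound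
  obtain ⟨n, hn, hnC⟩ := (hC.and (hlim.eventually_gt_atTop C)).exists
  have hSn : 0 < ‖S n‖ := norm_pos_iff.2 (hS n)
  have hn' : ‖S n‖ * ‖(Polynomial.X * q).eval (k ^ n)‖ ≤ ‖S n‖ * C := by
    rw [← norm_mul, mul_comm _ C]
    exact hn
  exact hnC.not_ge (le_of_mul_le_mul_left hn' hSn)

end Growth

end ParamODE

theorem mainTheorem5 (Ω : Set (ℝ × ℝ)) (hΩ : IsOpen Ω)
    (hcomp : ∃ z ∈ Ω, ¬ ParamODE.IsXSimple (connectedComponentIn Ω z))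
    (P : ParamODE.DO Ω) (hP : 1 ≤ P.ord) :
    ¬ FiniteDimensional ℝ (C(Ω, ℝ) ⧸ LinearMap.range P.toLinearMap) := by
  obtain ⟨z, -, hz⟩ := hcomp
  have hsep : ¬ ParamODE.IsLeafSeparated Ω := fun hsep =>
    hz (hsep.isXSimple_connectedComponentIn hΩ z)
  obtain ⟨t, a, b, c, hc, hta, htb, htc, hfreq⟩ :=
    ParamODE.exists_frequently_Icc_subset_of_not_isLeafSeparated hsep
  obtain ⟨T, S, hS, hT⟩ := P.exists_linearMap_isBigO hP hc hta htb htc hfreq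
  exact ParamODE.not_finiteDimensional_quotient_of_isBigO _ T hS hT
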